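/- **Setting.** Let $M=(\mathcal S,\mathcal A,P,R,\gamma,s_0)$ be a Markov decision process with finite state and action spaces, rewards $R:\mathcal S\times\mathcal A\to[0,R_{\max}]$, discount factor $\gamma\in[0,1)$ and deterministic initial state $s_0$; put $V_{\max}=R_{\max}/(1-\gamma)$. For a policy $\pi:\mathcal S\to\Delta(\mathcal A)$ let $J(\pi)=\mathbb E[\sum_{t\ge0}\gamma^tR(s_t,a_t)\mid\pi]$, let $d_\pi(s,a)=(1-\gamma)\sum_{t\ge 0}\gamma^t\Pr[s_t=s,a_t=a\mid\pi]$, and let $(\mathcal T^\pi f)(s,a)=R(s,a)+\gamma\,\mathbb E_{s'\sim P(\cdot|s,a)}[f(s',\pi)]$ with $f(s,\pi)=\mathbb E_{a\sim\pi(\cdot|s)}[f(s,a)]$. For a distribution $\nu$ on $\mathcal S\times\mathcal A$ write $\|f\|_{2,\nu}^2=\mathbb E_\nu[f^2]$, and let $$\mathscr C(\nu;\mu,\mathcal F,\pi)=\max_{f\in\mathcal F}\frac{\|f-\mathcal T^\pi f\|_{2,\nu}^2}{\|f-\mathcal T^\pi f\|_{2,\mu}^2}\in[0,\infty]\qquad(x/0=\infty\text{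 for }x>0,\ 0/0=0).$$ Let $\Pi$ be a finite class of policies and $\mathcal F$ a finite nonempty class of functions $\mathcal S\times\mathcal A\to[0,V_{\max}]$. The dataset $\mathcal D$ consists of $n\ge1$ i.i.d. tuples $(s,a,r,s')$ with $(s,a)\sim\mu$, $r=R(s,a)$, $s'\sim P(\cdot|s,a)$. Assume that for every $\pi\in\Pi$: * (realizability) $\inf_{f\in\mathcal F}\sup_{\nu}\|f-\mathcal T^\pi f\|_{2,\nu}^2\le\varepsilon_{\mathcal F}$, the supremum being over $\nu\in\{d_{\pi'}:\pi'\in\Pi\}\cup\{\mu\}$; * (completeness) $\sup_{f\in\mathcal F}\inf_{f'\in\mathcal F}\|f'-\mathcal T^\pi f\|_{2,\mu}^2\le\varepsilon_{\mathcal F,\mathcal F}$. **Algorithm.** Let $\mathcal L(f',f,\pi;\mathcal D)=\frac1n\sum_{(s,a,r,s')\in\mathcal D}(f'(s,a)-r-\gamma f(s',\pi))^2$ and $\mathcal E(f,\pi;\mathcal D)=\mathcal L(f,f,\pi;\mathcal D)-\min_{f'\in\mathcal F}\mathcal L(f',f,\pi;\mathcal D)$. For $\delta\in(0,1)$ put $$\varepsilon_r=\frac{139V_{\max}^2\log\frac{|\mathcal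 F||\Pi|}{\delta}}{n}+39\,\varepsilon_{\mathcal F},\qquad \mathcal F_{\pi,\varepsilon_r}=\{f\in\mathcal F:\mathcal E(f,\pi;\mathcal D)\le\varepsilon_r\},$$ and let $\hat\pi\in\operatorname{argmax}_{\pi\in\Pi}\min_{f\in\mathcal F_{\pi,\varepsilon_r}}f(s_0,\pi)$ (any maximizer; on datasets for which some $\mathcal F_{\pi,\varepsilon_r}$ is empty, $\hat\pi\in\Pi$ is arbitrary). **Corollary (Competing with optimal policy).** There is a universal constant $c>0$ such that in every such setting the following holds. Let $\pi^\star\in\Pi$ be an optimal policy, i.e. $J(\pi)\le J(\pi^\star)$ for all policies $\pi$, and let $C_2\ge1$ satisfy $\mathscr C(d_{\pi^\star};\mu,\mathcal F,\pi^\star)\le C_2$. Then, with probability at least $1-\delta$ over $\mathcal D$, $$J(\pi^\star)-J(\hat\pi)\le c\left(\frac{V_{\max}\sqrt{C_2}}{1-\gamma}\sqrt{\frac{\log\frac{|\mathcal F||\Pi|}{\delta}}{n}}+\frac{\sqrt{C_2(\varepsilon_{\mathcal F,\mathcal F}+\varepsilon_{\mathcal F})}}{1-\gamma}\right).$$ In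 particular only coverage of $\pi^\star$ is required, not of all policies in $\Pi$. -/

import Mathlib

open scoped ENNReal

noncomputable section

/-- A discounted Markov decision process `(S, A, P, R, γ, s₀)` with rewards in `[0, Rmax]`. -/
structure MDP (S A : Type*) where
  P : S × A → PMF S
  R : S × A → ℝ
  Rmax : ℝ
  R_nonneg : ∀ x, 0 ≤ R x
  R_le : ∀ x, R x ≤ Rmax
  γ : ℝ
  γ_nonneg : 0 ≤ γ
  γ_lt_one : γ < 1
  s₀ : S

/-- Stochastic (stationary) policies `S → Δ(A)`. -/
abbrev Policy (S A : Type*) := S → PMF A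

/-- A data point `(s, a, r, s')`. -/
abbrev Transition (S A : Type*) := S × A × ℝ × S

/-- `f(s, π) = 𝔼_{a ∼ π(·|s)} f(s, a)`. -/
def policyValue {S A : Type*} [Fintype A] (f : S × A → ℝ) (s : S) (π : Policy S A) : ℝ :=
  ∑ a, (π s a).toReal * f (s, a)

/-- `‖f‖²_{2,ν} = 𝔼_ν[f²]` for a state-action distribution `ν`, given by its mass function. -/
def sqNorm {S A : Type*} [Fintype S] [Fintype A] (ν : S × A → ℝ) (f : S × A → ℝ) : ℝ :=
  ∑ x, ν x * f x ^ 2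

/-- The mass function of a distribution on state-action pairs. -/
def massFun {S A : Type*} (μ : PMF (S × A)) : S × A → ℝ := fun x => (μ x).toReal

namespace MDP

variable {S A : Type*}

/-- `Vmax = Rmax / (1 - γ)`. -/
def Vmax (M : MDP S A) : ℝ := M.Rmax / (1 - M.γ)

/-- The law of `(s_t, a_t)` along the trajectory that `π` induces from `s₀`. -/
def stepLaw (M : MDP S A) (π : Policy S A) : ℕ → PMF (S × A)
  | 0 => (π M.s₀).map fun a => (M.s₀, a)
  | t + 1 => (stepLaw M π t).bind fun x => (M.P x).bind fun s' => (π s').map fun a' => (s', a')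

/-- The expected discounted return `J(π) = 𝔼[∑_t γ^t r_t | π]`, with `r_t = R(s_t, a_t)`. -/
def J [Fintype S] [Fintype A] (M : MDP S A) (π : Policy S A) : ℝ :=
  ∑' t : ℕ, M.γ ^ t * ∑ x, (M.stepLaw π t x).toReal * M.R x

/-- The discounted occupancy `d_π(s, a) = (1 - γ) ∑_t γ^t Pr[s_t = s, a_t = a | π]`. -/
def occupancy (M : MDP S A) (π : Policy S A) : S × A → ℝ :=
  fun x => (1 - M.γ) * ∑' t : ℕ, M.γ ^ t * (M.stepLaw π t x).toReal

/-- The Bellman operator `(T^π f)(s, a) = R(s, a) + γ 𝔼_{s' ∼ P(·|s,a)} f(s', π)`. -/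
def bellman [Fintype S] [Fintype A] (M : MDP S A) (π : Policy S A) (f : S × A → ℝ) :
    S × A → ℝ :=
  fun x => M.R x + M.γ * ∑ s', (M.P x s').toReal * policyValue f s' π

/-- `inf_{f ∈ F} sup_{ν ∈ N} ‖f - T^π f‖²_{2,ν}`. -/
def realizabilityError [Fintype S] [Fintype A] (M : MDP S A) (F : Finset (S × A → ℝ))
    (N : Set (S × A → ℝ)) (π : Policy S A) : ℝ :=
  ⨅ f : F, ⨆ ν : N, sqNorm ν.1 (f.1 - M.bellman π f.1)

/-- `sup_{f ∈ F} inf_{f' ∈ F} ‖f' - T^π f‖²_{2,μ}`. -/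
def completenessError [Fintype S] [Fintype A] (M : MDP S A) (F : Finset (S × A → ℝ))
    (μ : S × A → ℝ) (π : Policy S A) : ℝ :=
  ⨆ f : F, ⨅ f' : F, sqNorm μ (f'.1 - M.bellman π f.1)

/-- The distribution shift `𝒞(ν; μ, F, π) = max_{f ∈ F} ‖f - T^π f‖²_{2,ν} / ‖f - T^π f‖²_{2,μ}`.
It takes values in `[0, ∞]`; here `x / 0 = ∞` for `x > 0`, and `0 / 0 = 0`. -/
def concentrability [Fintype S] [Fintype A] (M : MDP S A) (ν μ : S × A → ℝ)
    (F : Finset (S × A → ℝ)) (π : Policy S A) : ℝ≥0∞ :=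
  ⨆ f ∈ F, ENNReal.ofReal (sqNorm ν (f - M.bellman π f)) /
    ENNReal.ofReal (sqNorm μ (f - M.bellman π f))

/-- The law of `(s, a, r, s')` with `(s, a) ∼ μ`, `r = R(s, a)`, `s' ∼ P(·|s, a)`. -/
def sampleLaw (M : MDP S A) (μ : PMF (S × A)) : PMF (Transition S A) :=
  μ.bind fun x => (M.P x).map fun s' => (x.1, x.2, M.R x, s')

/-- The law of a dataset of `n` i.i.d. transitions. -/
def datasetLaw [MeasurableSpace S] [MeasurableSpace A] (M : MDP S A) (μ : PMF (S × A)) (n : ℕ) :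
    MeasureTheory.Measure (Fin n → Transition S A) :=
  MeasureTheory.Measure.pi fun _ => (M.sampleLaw μ).toMeasure

/-- The empirical loss
`L(f', f, π; D) = (1/n) ∑_{(s,a,r,s') ∈ D} (f'(s, a) - r - γ f(s', π))²`. -/
def empLoss [Fintype A] (M : MDP S A) {n : ℕ} (D : Fin n → Transition S A)
    (f' f : S × A → ℝ) (π : Policy S A) : ℝ :=
  (1 / (n : ℝ)) * ∑ i, (f' ((D i).1, (D i).2.1) - (D i).2.2.1
    - M.γ * policyValue f (D i).2.2.2 π) ^ 2

/-- The empirical Bellman error `E(f, π; D) = L(f, f, π; D) - min_{f' ∈ F} L(f', f, π; D)`. -/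
def empBellmanError [Fintype A] (M : MDP S A) (F : Finset (S × A → ℝ)) {n : ℕ}
    (D : Fin n → Transition S A) (f : S × A → ℝ) (π : Policy S A) : ℝ :=
  M.empLoss D f f π - ⨅ f' : F, M.empLoss D f'.1 f π

/-- The version space `F_{π,ε} = {f ∈ F : E(f, π; D) ≤ ε}`. -/
def versionSpace [Fintype A] (M : MDP S A) (F : Finset (S × A → ℝ)) {n : ℕ}
    (D : Fin n → Transition S A) (ε : ℝ) (π : Policy S A) : Set (S × A → ℝ) :=
  {f | f ∈ F ∧ M.empBellmanError F D f π ≤ ε}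

/-- The pessimistic value `min_{f ∈ F_{π,ε}} f(s₀, π)`, meaningful if `F_{π,ε}` is nonempty. -/
def pessimisticValue [Fintype A] (M : MDP S A) (F : Finset (S × A → ℝ)) {n : ℕ}
    (D : Fin n → Transition S A) (ε : ℝ) (π : Policy S A) : ℝ :=
  ⨅ f : M.versionSpace F D ε π, policyValue f.1 M.s₀ π

/-- `πhat` is a version of `D ↦ argmax_{π ∈ Pol} min_{f ∈ F_{π,ε}} f(s₀, π)`, with values in the
policy class. On a dataset for which some version space is empty, so that the inner minimum is
undefined, the choice in the policy class is arbitrary. -/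
def IsPessimisticPolicy [Fintype A] (M : MDP S A) (F : Finset (S × A → ℝ))
    (Pol : Finset (Policy S A)) (ε : ℝ) {n : ℕ}
    (πhat : (Fin n → Transition S A) → Policy S A) : Prop :=
  ∀ D, πhat D ∈ Pol ∧ ((∀ π ∈ Pol, (M.versionSpace F D ε π).Nonempty) →
    ∀ π ∈ Pol, M.pessimisticValue F D ε π ≤ M.pessimisticValue F D ε (πhat D))

/-- The threshold `ε_r = 139 Vmax² log(|F||Π|/δ) / n + 39 ε_F`. -/
def threshold (M : MDP S A) (F : Finset (S × A → ℝ)) (Pol : Finset (Policy S A))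
    (δ : ℝ) (n : ℕ) (εF : ℝ) : ℝ :=
  139 * M.Vmax ^ 2 * Real.log ((F.card : ℝ) * (Pol.card : ℝ) / δ) / n + 39 * εF

end MDP

end

/-! ### Elementary inequalities and finite averages. -/

open MeasureTheory

/-! The error f(s₀, π) − J(π) is the mean Bellman residual of f under d_π, divided by 1 − γ
(`policyValue_sub_J`). Pessimism needs this for two functions only. The realizing function of π̂
bounds the pessimistic value of π̂ from above, and its residual under d_π̂ is small by assumption.
The minimizer in the version space of π⋆ has its residual transferred from μ to d_π⋆ by coverage. So
no other policy has to be covered (`J_sub_J_le_of_isPessimisticPolicy`).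

It remains to show that, with high probability, realizing functions lie in their version spaces and
members of the version space of π⋆ have small residual under μ. Both facts compare two empirical
losses with the same regression target. The variance of the target cancels: the mean difference is
the difference of the squared residual norms, and the second moment is at most 8 Vmax² times their
sum. Since the variance is thus controlled by the residuals, a Chernoff bound gives the fast rate
1/n (`measureReal_le_empLoss_sub_le`). Completeness supplies the competitor in the second
comparison, and a union bound concludes. -/

theorem Real.exp_le_one_add_add_sq {x : ℝ} (hx : |x| ≤ 1) : Real.exp x ≤ 1 + x + x ^ 2 := by
  have h := Real.norm_exp_sub_one_sub_id_le (x := x) (by simpa using hx)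
  rw [Real.norm_eq_abs, Real.norm_eq_abs, sq_abs] at h
  linarith [(abs_le.1 h).2]

theorem PMF.sum_toReal {α : Type*} [Fintype α] (p : PMF α) : ∑ x, (p x).toReal = 1 := by
  rw [← ENNReal.toReal_sum fun x _ => p.apply_ne_top x, ← tsum_fintype (L := .unconditional _),
    p.tsum_coe, ENNReal.toReal_one]

theorem sqNorm_nonneg {S A : Type*} [Fintype S] [Fintype A] {ν : S × A → ℝ} (hν : ∀ x, 0 ≤ ν x)
    (f : S × A → ℝ) : 0 ≤ sqNorm ν f :=
  Finset.sum_nonneg fun x _ => mul_nonneg (hν x) (sq_nonneg _)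

theorem massFun_nonneg {S A : Type*} (μ : PMF (S × A)) (x : S × A) : 0 ≤ massFun μ x :=
  ENNReal.toReal_nonneg

/-- Jensen's inequality in the form `|𝔼_ν f| ≤ ‖f‖_{2,ν}`. -/
theorem abs_sum_le_sqrt_sqNorm {S A : Type*} [Fintype S] [Fintype A] {ν : S × A → ℝ}
    (hν : ∀ x, 0 ≤ ν x) (h1 : ∑ x, ν x = 1) (f : S × A → ℝ) :
    |∑ x, ν x * f x| ≤ √(sqNorm ν f) := by
  apply Real.abs_le_sqrt
  set m := ∑ x, ν x * f x with hm
  have h : 0 ≤ ∑ x, ν x * (f x - m) ^ 2 :=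
    Finset.sum_nonneg fun x _ => mul_nonneg (hν x) (sq_nonneg _)
  have e : ∑ x, ν x * (f x - m) ^ 2 = sqNorm ν f - 2 * m * m + m ^ 2 * 1 := by
    rw [← h1, sqNorm]
    nth_rw 3 [hm]
    simp only [Finset.mul_sum, ← Finset.sum_sub_distrib, ← Finset.sum_add_distrib]
    exact Finset.sum_congr rfl fun x _ => by ring
  nlinarith

theorem policyValue_mem_Icc {S A : Type*} [Fintype A] {f : S × A → ℝ} {V : ℝ}
    (hf : ∀ x, f x ∈ Set.Icc 0 V) (s : S) (π : Policy S A) :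
    policyValue f s π ∈ Set.Icc 0 V := by
  refine ⟨Finset.sum_nonneg fun a _ => mul_nonneg ENNReal.toReal_nonneg (hf _).1, ?_⟩
  calc policyValue f s π ≤ ∑ a, (π s a).toReal * V :=
        Finset.sum_le_sum fun a _ => mul_le_mul_of_nonneg_left (hf _).2 ENNReal.toReal_nonneg
    _ = V := by rw [← Finset.sum_mul, PMF.sum_toReal, one_mul]

/-! ### Exponential moments and concentration of loss differences. -/

namespace MDP

variable {S A : Type*}

theorem Rmax_eq (M : MDP S A) : M.Rmax = (1 - M.γ) * M.Vmax := by
  have := M.γ_lt_one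
  rw [Vmax]
  field_simp [(by linarith : 1 - M.γ ≠ 0)]

/-- A pair of squared errors of the regression target, as a function of a transition. -/
def lossDiff [Fintype A] (M : MDP S A) (f₁ f₂ f : S × A → ℝ) (π : Policy S A)
    (z : Transition S A) : ℝ :=
  (f₁ (z.1, z.2.1) - z.2.2.1 - M.γ * policyValue f z.2.2.2 π) ^ 2
    - (f₂ (z.1, z.2.1) - z.2.2.1 - M.γ * policyValue f z.2.2.2 π) ^ 2

theorem empLoss_sub_empLoss [Fintype A] (M : MDP S A) {n : ℕ} (D : Fin n → Transition S A)
    (f₁ f₂ f : S × A → ℝ) (π : Policy S A) :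
    M.empLoss D f₁ f π - M.empLoss D f₂ f π
      = (1 / (n : ℝ)) * ∑ i, M.lossDiff f₁ f₂ f π (D i) := by
  simp only [empLoss, lossDiff, Finset.sum_sub_distrib, mul_sub]

variable [Fintype S] [Fintype A]

/-- With target y and residuals g, h of f₁, f₂, the loss difference is (f₁ − f₂)(f₁ + f₂ − 2y). It
is affine in y, so its conditional mean is g² − h². As f₁ − f₂ = g − h and |f₁ + f₂ − 2y| ≤ 2 Vmax,
its square is at most 8 Vmax² (g² + h²). -/
theorem sum_P_exp_lossDiff_le (M : MDP S A) {f₁ f₂ f : S × A → ℝ}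
    (h₁ : ∀ x, f₁ x ∈ Set.Icc 0 M.Vmax) (h₂ : ∀ x, f₂ x ∈ Set.Icc 0 M.Vmax)
    (hf : ∀ x, f x ∈ Set.Icc 0 M.Vmax) (π : Policy S A) {l : ℝ} (hl : 0 ≤ l)
    (hlV : l * M.Vmax ^ 2 ≤ 1) (x : S × A) :
    ∑ s', (M.P x s').toReal * Real.exp (l * M.lossDiff f₁ f₂ f π (x.1, x.2, M.R x, s'))
      ≤ 1 + l * ((f₁ - M.bellman π f) x ^ 2 - (f₂ - M.bellman π f) x ^ 2)
        + 8 * l ^ 2 * M.Vmax ^ 2 *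
          ((f₁ - M.bellman π f) x ^ 2 + (f₂ - M.bellman π f) x ^ 2) := by
  set V := M.Vmax
  set g := (f₁ - M.bellman π f) x with hg
  set h := (f₂ - M.bellman π f) x with hh
  have hgh : f₁ x - f₂ x = g - h := by simp [hg, hh]
  have key : ∀ s', Real.exp (l * M.lossDiff f₁ f₂ f π (x.1, x.2, M.R x, s'))
      ≤ 1 + l * ((f₁ x - f₂ x) * (f₁ x + f₂ x - 2 * (M.R x + M.γ * policyValue f s' π)))
        + 8 * l ^ 2 * V ^ 2 * (g ^ 2 + h ^ 2) := by
    intro s'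
    obtain ⟨hp0, hp1⟩ := policyValue_mem_Icc hf s' π
    have hy0 : 0 ≤ M.R x + M.γ * policyValue f s' π :=
      add_nonneg (M.R_nonneg x) (mul_nonneg M.γ_nonneg hp0)
    have hy1 : M.R x + M.γ * policyValue f s' π ≤ V := by
      have := M.R_le x
      rw [M.Rmax_eq] at this
      have := mul_le_mul_of_nonneg_left hp1 M.γ_nonneg
      linarith
    have e : M.lossDiff f₁ f₂ f π (x.1, x.2, M.R x, s')
        = (f₁ x - f₂ x) * (f₁ x + f₂ x - 2 * (M.R x + M.γ * policyValue f s' π)) := by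
      simp only [lossDiff]
      ring
    set y := M.R x + M.γ * policyValue f s' π
    have e' : M.lossDiff f₁ f₂ f π (x.1, x.2, M.R x, s') = (f₁ x - y) ^ 2 - (f₂ x - y) ^ 2 := by
      rw [e]; ring
    obtain ⟨h10, h11⟩ := h₁ x
    obtain ⟨h20, h21⟩ := h₂ x
    have hX : |M.lossDiff f₁ f₂ f π (x.1, x.2, M.R x, s')| ≤ V ^ 2 := by
      have b1 : (f₁ x - y) ^ 2 ≤ V ^ 2 := sq_le_sq' (by linarith) (by linarith)
      have b2 : (f₂ x - y) ^ 2 ≤ V ^ 2 := sq_le_sq' (by linarith) (by linarith)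
      rw [e', abs_le]
      constructor <;> nlinarith [sq_nonneg (f₁ x - y), sq_nonneg (f₂ x - y)]
    have hlX : |l * M.lossDiff f₁ f₂ f π (x.1, x.2, M.R x, s')| ≤ 1 := by
      rw [abs_mul, abs_of_nonneg hl]
      exact (mul_le_mul_of_nonneg_left hX hl).trans hlV
    refine (Real.exp_le_one_add_add_sq hlX).trans ?_
    rw [e, mul_pow, mul_pow]
    have b3 : (f₁ x + f₂ x - 2 * y) ^ 2 ≤ (2 * V) ^ 2 := sq_le_sq' (by linarith) (by linarith)
    have b4 : (f₁ x - f₂ x) ^ 2 ≤ 2 * (g ^ 2 + h ^ 2) := by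
      rw [hgh]; nlinarith [sq_nonneg (g + h)]
    have b5 : (f₁ x - f₂ x) ^ 2 * (f₁ x + f₂ x - 2 * y) ^ 2
        ≤ 2 * (g ^ 2 + h ^ 2) * (2 * V) ^ 2 :=
      mul_le_mul b4 b3 (sq_nonneg _) (by positivity)
    have := mul_le_mul_of_nonneg_left b5 (sq_nonneg l)
    linarith
  calc _ ≤ ∑ s', (M.P x s').toReal *
        (1 + l * ((f₁ x - f₂ x) * (f₁ x + f₂ x - 2 * (M.R x + M.γ * policyValue f s' π)))
        + 8 * l ^ 2 * V ^ 2 * (g ^ 2 + h ^ 2)) :=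
        Finset.sum_le_sum fun s' _ => mul_le_mul_of_nonneg_left (key s') ENNReal.toReal_nonneg
    _ = (∑ s', (M.P x s').toReal) *
          (1 + l * ((f₁ x - f₂ x) * (f₁ x + f₂ x - 2 * M.R x))
            + 8 * l ^ 2 * V ^ 2 * (g ^ 2 + h ^ 2))
        - 2 * l * (f₁ x - f₂ x) * (M.γ * ∑ s', (M.P x s').toReal * policyValue f s' π) := by
      simp only [Finset.mul_sum, Finset.sum_mul, ← Finset.sum_sub_distrib]
      exact Finset.sum_congr rfl fun x _ => by ring
    _ = _ := by
      rw [PMF.sum_toReal, one_mul]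
      have : M.γ * ∑ s', (M.P x s').toReal * policyValue f s' π = M.bellman π f x - M.R x := by
        simp [bellman]
      rw [this, hg, hh]
      simp only [Pi.sub_apply]
      ring

theorem sum_exp_lossDiff_le (M : MDP S A) (μ : PMF (S × A)) {f₁ f₂ f : S × A → ℝ}
    (h₁ : ∀ x, f₁ x ∈ Set.Icc 0 M.Vmax) (h₂ : ∀ x, f₂ x ∈ Set.Icc 0 M.Vmax)
    (hf : ∀ x, f x ∈ Set.Icc 0 M.Vmax) (π : Policy S A) {l : ℝ} (hl : 0 ≤ l)
    (hlV : l * M.Vmax ^ 2 ≤ 1) :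
    ∑ x, (μ x).toReal * ∑ s', (M.P x s').toReal *
        Real.exp (l * M.lossDiff f₁ f₂ f π (x.1, x.2, M.R x, s'))
      ≤ Real.exp (l * (sqNorm (massFun μ) (f₁ - M.bellman π f)
          - sqNorm (massFun μ) (f₂ - M.bellman π f))
        + 8 * l ^ 2 * M.Vmax ^ 2 * (sqNorm (massFun μ) (f₁ - M.bellman π f)
          + sqNorm (massFun μ) (f₂ - M.bellman π f))) := by
  refine le_trans ?_ (Real.add_one_le_exp _)
  refine (Finset.sum_le_sum fun x _ => mul_le_mul_of_nonneg_left
    (M.sum_P_exp_lossDiff_le h₁ h₂ hf π hl hlV x) ENNReal.toReal_nonneg).trans (le_of_eq ?_)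
  rw [← PMF.sum_toReal μ]
  simp only [sqNorm, massFun, Finset.mul_sum, ← Finset.sum_sub_distrib,
    ← Finset.sum_add_distrib]
  exact Finset.sum_congr rfl fun x _ => by rw [PMF.sum_toReal]; ring

variable [MeasurableSpace S] [DiscreteMeasurableSpace S]
  [MeasurableSpace A] [DiscreteMeasurableSpace A]

/-- The reward coordinate is real, so transitions do not form a finite space. The reward is a
function of (s, a), however, so the law is pushed forward from a finite space, where integrals are
finite sums. -/
theorem toMeasure_sampleLaw (M : MDP S A) (μ : PMF (S × A)) :
    (M.sampleLaw μ).toMeasure =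
      (μ.bind fun x => (M.P x).map fun s' => (x, s')).toMeasure.map
        fun w => (w.1.1, w.1.2, M.R w.1, w.2) := by
  rw [PMF.toMeasure_map _ _ Measurable.of_discrete, PMF.map_bind]
  simp only [PMF.map_comp]
  rfl

theorem integrable_sampleLaw (M : MDP S A) (μ : PMF (S × A)) {h : Transition S A → ℝ}
    (hh : Measurable h) : Integrable h (M.sampleLaw μ).toMeasure := by
  rw [toMeasure_sampleLaw, integrable_map_measure hh.aestronglyMeasurable
    Measurable.of_discrete.aemeasurable]
  exact Integrable.of_finite

theorem integral_sampleLaw (M : MDP S A) (μ : PMF (S × A)) {h : Transition S A → ℝ}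
    (hh : Measurable h) :
    ∫ z, h z ∂(M.sampleLaw μ).toMeasure =
      ∑ x, (μ x).toReal * ∑ s', (M.P x s').toReal * h (x.1, x.2, M.R x, s') := by
  classical
  rw [toMeasure_sampleLaw, integral_map Measurable.of_discrete.aemeasurable
    hh.aestronglyMeasurable, PMF.integral_eq_sum, Fintype.sum_prod_type]
  refine Finset.sum_congr rfl fun x _ => ?_
  rw [Finset.mul_sum]
  refine Finset.sum_congr rfl fun s' _ => ?_
  have : (μ.bind fun x => (M.P x).map fun s' => (x, s')) (x, s') = μ x * M.P x s' := by
    rw [PMF.bind_apply, tsum_eq_single x, PMF.map_apply, tsum_eq_single s'] <;>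
      simp +contextual [PMF.map_apply, eq_comm]
  rw [this, ENNReal.toReal_mul, smul_eq_mul, mul_assoc]

theorem measurable_lossDiff (M : MDP S A) (f₁ f₂ f : S × A → ℝ) (π : Policy S A) :
    Measurable (M.lossDiff f₁ f₂ f π) := by
  have m₁ : Measurable f₁ := Measurable.of_discrete
  have m₂ : Measurable f₂ := Measurable.of_discrete
  have m : Measurable fun s => policyValue f s π := Measurable.of_discrete
  have p : Measurable fun z : Transition S A => (z.1, z.2.1) := by fun_prop
  have q : Measurable fun z : Transition S A => policyValue f z.2.2.2 π :=
    m.comp (by fun_prop)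
  have q₁ := m₁.comp p
  have q₂ := m₂.comp p
  simp only [Function.comp_def] at q₁ q₂
  unfold lossDiff
  fun_prop

instance (M : MDP S A) (μ : PMF (S × A)) (n : ℕ) : IsProbabilityMeasure (M.datasetLaw μ n) := by
  unfold datasetLaw; infer_instance

/-- Chernoff bound for the difference of two empirical losses. -/
theorem measureReal_le_empLoss_sub_le (M : MDP S A) (μ : PMF (S × A)) {f₁ f₂ f : S × A → ℝ}
    (h₁ : ∀ x, f₁ x ∈ Set.Icc 0 M.Vmax) (h₂ : ∀ x, f₂ x ∈ Set.Icc 0 M.Vmax)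
    (hf : ∀ x, f x ∈ Set.Icc 0 M.Vmax) (π : Policy S A) {l : ℝ} (hl : 0 ≤ l)
    (hlV : l * M.Vmax ^ 2 ≤ 1) {n : ℕ} (hn : 0 < n) (t : ℝ) :
    (M.datasetLaw μ n).real {D | t ≤ M.empLoss D f₁ f π - M.empLoss D f₂ f π}
      ≤ Real.exp (n * (-(l * t) + (l * (sqNorm (massFun μ) (f₁ - M.bellman π f)
          - sqNorm (massFun μ) (f₂ - M.bellman π f))
        + 8 * l ^ 2 * M.Vmax ^ 2 * (sqNorm (massFun μ) (f₁ - M.bellman π f)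
          + sqNorm (massFun μ) (f₂ - M.bellman π f))))) := by
  have hm : Measurable fun z => Real.exp (l * M.lossDiff f₁ f₂ f π z) :=
    Real.measurable_exp.comp ((M.measurable_lossDiff f₁ f₂ f π).const_mul l)
  have hint : Integrable (fun D : Fin n → Transition S A =>
      ∏ i, Real.exp (l * M.lossDiff f₁ f₂ f π (D i))) (M.datasetLaw μ n) :=
    Integrable.fintype_prod fun _ => M.integrable_sampleLaw μ hm
  have hmarkov := mul_meas_ge_le_integral_of_nonneg
    (Filter.Eventually.of_forall fun D => Finset.prod_nonneg fun i _ => (Real.exp_pos _).le)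
    hint (Real.exp (n * (l * t)))
  -- Independence of the samples: the moment generating function factorizes.
  have hval : ∫ D : Fin n → Transition S A, ∏ i, Real.exp (l * M.lossDiff f₁ f₂ f π (D i))
      ∂(M.datasetLaw μ n) = (∑ x, (μ x).toReal * ∑ s', (M.P x s').toReal *
        Real.exp (l * M.lossDiff f₁ f₂ f π (x.1, x.2, M.R x, s'))) ^ n := by
    rw [datasetLaw, integral_fintype_prod_eq_pow (ι := Fin n)
      fun z => Real.exp (l * M.lossDiff f₁ f₂ f π z), M.integral_sampleLaw μ hm, Fintype.card_fin]
  have hset : {D : Fin n → Transition S A | t ≤ M.empLoss D f₁ f π - M.empLoss D f₂ f π}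
      ⊆ {D | Real.exp (n * (l * t)) ≤ ∏ i, Real.exp (l * M.lossDiff f₁ f₂ f π (D i))} := by
    intro D hD
    have hn' : (0 : ℝ) < n := by exact_mod_cast hn
    simp only [Set.mem_ofPred_eq] at hD ⊢
    rw [← Real.exp_sum, Real.exp_le_exp, ← Finset.mul_sum]
    rw [empLoss_sub_empLoss, one_div, ← div_eq_inv_mul, le_div_iff₀ hn'] at hD
    calc (n : ℝ) * (l * t) = l * (t * n) := by ring
      _ ≤ _ := mul_le_mul_of_nonneg_left hD hl
  have hpow := pow_le_pow_left₀ (Finset.sum_nonneg fun x _ => mul_nonneg ENNReal.toReal_nonneg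
    (Finset.sum_nonneg fun s' _ => mul_nonneg ENNReal.toReal_nonneg (Real.exp_pos _).le))
    (M.sum_exp_lossDiff_le μ h₁ h₂ hf π hl hlV) n
  rw [← Real.exp_nat_mul] at hpow
  have := (mul_le_mul_of_nonneg_left (measureReal_mono hset) (Real.exp_pos _).le).trans
    (hmarkov.trans (hval.le.trans hpow))
  rw [mul_add, Real.exp_add, mul_neg, Real.exp_neg, inv_mul_eq_div, le_div_iff₀ (Real.exp_pos _),
    mul_comm]
  exact this

end MDP

/-! ### Occupancies, evaluation error and pessimism. -/

namespace MDP

variable {S A : Type*}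

theorem Vmax_nonneg (M : MDP S A) (π : Policy S A) : 0 ≤ M.Vmax := by
  obtain ⟨a, _⟩ := (π M.s₀).support_nonempty
  exact div_nonneg ((M.R_nonneg (M.s₀, a)).trans (M.R_le _)) (by linarith [M.γ_lt_one])

theorem occupancy_nonneg (M : MDP S A) (π : Policy S A) (x : S × A) : 0 ≤ M.occupancy π x :=
  mul_nonneg (by linarith [M.γ_lt_one])
    (tsum_nonneg fun t => mul_nonneg (pow_nonneg M.γ_nonneg t) ENNReal.toReal_nonneg)

theorem summable_discounted (M : MDP S A) (π : Policy S A) (x : S × A) :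
    Summable fun t : ℕ => M.γ ^ t * (M.stepLaw π t x).toReal := by
  refine Summable.of_nonneg_of_le
    (fun t => mul_nonneg (pow_nonneg M.γ_nonneg t) ENNReal.toReal_nonneg) (fun t => ?_)
    (summable_geometric_of_lt_one M.γ_nonneg M.γ_lt_one)
  refine mul_le_of_le_one_right (pow_nonneg M.γ_nonneg t) ?_
  exact ENNReal.toReal_le_of_le_ofReal zero_le_one (by simpa using PMF.coe_le_one _ _)

theorem mem_versionSpace_of_forall [Fintype A] (M : MDP S A) {F : Finset (S × A → ℝ)} {n : ℕ}
    {D : Fin n → Transition S A} {ε : ℝ} {π : Policy S A} {f : S × A → ℝ} (hf : f ∈ F)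
    (h : ∀ f' ∈ F, M.empLoss D f f π - M.empLoss D f' f π ≤ ε) : f ∈ M.versionSpace F D ε π := by
  have : Nonempty F := ⟨⟨f, hf⟩⟩
  refine ⟨hf, ?_⟩
  have : M.empLoss D f f π - ε ≤ ⨅ f' : F, M.empLoss D f'.1 f π :=
    le_ciInf fun f' => by linarith [h f'.1 f'.2]
  rw [empBellmanError]
  linarith

theorem empLoss_sub_le_of_mem_versionSpace [Fintype A] (M : MDP S A) {F : Finset (S × A → ℝ)} {n : ℕ}
    {D : Fin n → Transition S A} {ε : ℝ} {π : Policy S A} {f f' : S × A → ℝ}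
    (hf : f ∈ M.versionSpace F D ε π) (hf' : f' ∈ F) :
    M.empLoss D f f π - M.empLoss D f' f π ≤ ε := by
  have h := hf.2
  have h' : ⨅ f' : F, M.empLoss D f'.1 f π ≤ M.empLoss D f' f π :=
    ciInf_le (f := fun f' : F => M.empLoss D f'.1 f π) (Set.finite_range _).bddBelow ⟨f', hf'⟩
  rw [empBellmanError] at h
  linarith

variable [Fintype S] [Fintype A]

/-- Averaging against the occupancy is the normalized discounted sum of the averages in time. -/
theorem hasSum_occupancy (M : MDP S A) (π : Policy S A) (k : S × A → ℝ) :
    HasSum (fun t : ℕ => M.γ ^ t * ∑ x, (M.stepLaw π t x).toReal * k x)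
      ((∑ x, M.occupancy π x * k x) / (1 - M.γ)) := by
  have h : HasSum (fun t : ℕ => ∑ x, M.γ ^ t * (M.stepLaw π t x).toReal * k x)
      (∑ x, (∑' t : ℕ, M.γ ^ t * (M.stepLaw π t x).toReal) * k x) :=
    hasSum_sum fun x _ => (M.summable_discounted π x).hasSum.mul_right (k x)
  convert h using 1
  · funext t
    rw [Finset.mul_sum]
    exact Finset.sum_congr rfl fun x _ => by ring
  · have : 1 - M.γ ≠ 0 := by linarith [M.γ_lt_one]
    rw [Finset.sum_div]
    refine Finset.sum_congr rfl fun x _ => ?_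
    rw [occupancy]
    field_simp

theorem J_eq (M : MDP S A) (π : Policy S A) :
    M.J π = (∑ x, M.occupancy π x * M.R x) / (1 - M.γ) :=
  (M.hasSum_occupancy π M.R).tsum_eq

theorem sum_occupancy (M : MDP S A) (π : Policy S A) : ∑ x, M.occupancy π x = 1 := by
  have h := M.hasSum_occupancy π fun _ => 1
  simp only [mul_one, PMF.sum_toReal] at h
  have h' := h.unique (hasSum_geometric_of_lt_one M.γ_nonneg M.γ_lt_one)
  have : 1 - M.γ ≠ 0 := by linarith [M.γ_lt_one]
  field_simp at h'
  exact h'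

theorem sum_stepLaw_zero (M : MDP S A) (π : Policy S A) (f : S × A → ℝ) :
    ∑ x, (M.stepLaw π 0 x).toReal * f x = policyValue f M.s₀ π := by
  classical
  rw [Fintype.sum_prod_type, Finset.sum_eq_single M.s₀]
  · refine Finset.sum_congr rfl fun a _ => ?_
    have : M.stepLaw π 0 (M.s₀, a) = π M.s₀ a := by
      rw [stepLaw, PMF.map_apply, tsum_eq_single a] <;> simp +contextual [eq_comm]
    rw [this]
  · intro s _ hs
    refine Finset.sum_eq_zero fun a _ => ?_
    have : M.stepLaw π 0 (s, a) = 0 := by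
      rw [stepLaw, PMF.map_apply]; simp [hs]
    simp [this]
  · simp

theorem sum_stepLaw_succ (M : MDP S A) (π : Policy S A) (f : S × A → ℝ) (t : ℕ) :
    ∑ x, (M.stepLaw π (t + 1) x).toReal * f x =
      ∑ x, (M.stepLaw π t x).toReal * ∑ s', (M.P x s').toReal * policyValue f s' π := by
  classical
  have h : ∀ s' a', (M.stepLaw π (t + 1) (s', a')).toReal =
      ∑ x, (M.stepLaw π t x).toReal * ((M.P x s').toReal * (π s' a').toReal) := by
    intro s' a'
    have hm : ∀ s, ((π s).map fun a' => (s, a')) (s', a') = if s = s' then π s' a' else 0 := by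
      intro s
      split_ifs with hs
      · subst hs
        rw [PMF.map_apply, tsum_eq_single a'] <;> simp +contextual [eq_comm]
      · rw [PMF.map_apply]; simp [Ne.symm hs]
    rw [stepLaw, PMF.bind_apply, tsum_fintype, ENNReal.toReal_sum]
    · refine Finset.sum_congr rfl fun x _ => ?_
      rw [PMF.bind_apply, tsum_fintype]
      simp [hm, ENNReal.toReal_mul]
    · exact fun x _ => ENNReal.mul_ne_top (PMF.apply_ne_top _ _) (PMF.apply_ne_top _ _)
  rw [Fintype.sum_prod_type]
  simp only [h, policyValue, Finset.sum_mul, Finset.mul_sum]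
  rw [Finset.sum_congr rfl fun s' _ => Finset.sum_comm, Finset.sum_comm]
  exact Finset.sum_congr rfl fun x _ => Finset.sum_congr rfl fun s' _ =>
    Finset.sum_congr rfl fun a' _ => by ring

/-- Evaluation error as an average Bellman error under the occupancy. -/
theorem policyValue_sub_J (M : MDP S A) (π : Policy S A) (f : S × A → ℝ) :
    policyValue f M.s₀ π - M.J π =
      (∑ x, M.occupancy π x * (f - M.bellman π f) x) / (1 - M.γ) := by
  have hf := M.hasSum_occupancy π f
  -- Dropping the term t = 0 of the series for f leaves γ times the series for the expected
  -- next-step value of f.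
  have h1 := (hasSum_nat_add_iff' 1).2 hf
  have h2 := (M.hasSum_occupancy π fun x => ∑ s', (M.P x s').toReal * policyValue f s' π).mul_left
    M.γ
  have h3 : (∑ x, M.occupancy π x * f x) / (1 - M.γ) - policyValue f M.s₀ π =
      M.γ * ((∑ x, M.occupancy π x * ∑ s', (M.P x s').toReal * policyValue f s' π)
        / (1 - M.γ)) := by
    simp only [Finset.sum_range_one, sum_stepLaw_zero, sum_stepLaw_succ, pow_zero, one_mul,
      pow_succ', mul_assoc] at h1
    exact h1.unique h2
  have h4 : ∑ x, M.occupancy π x * (f - M.bellman π f) x = ∑ x, M.occupancy π x * f x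
      - ∑ x, M.occupancy π x * M.R x
      - M.γ * ∑ x, M.occupancy π x * ∑ s', (M.P x s').toReal * policyValue f s' π := by
    rw [Finset.mul_sum, ← Finset.sum_sub_distrib, ← Finset.sum_sub_distrib]
    refine Finset.sum_congr rfl fun x _ => ?_
    simp only [Pi.sub_apply, bellman]
    ring
  rw [h4, J_eq, sub_div, sub_div, mul_div_assoc, ← h3]
  ring

theorem abs_policyValue_sub_J_le (M : MDP S A) (π : Policy S A) (f : S × A → ℝ) :
    |policyValue f M.s₀ π - M.J π| ≤
      √(sqNorm (M.occupancy π) (f - M.bellman π f)) / (1 - M.γ) := by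
  have h : 0 < 1 - M.γ := by linarith [M.γ_lt_one]
  rw [policyValue_sub_J, abs_div, abs_of_pos h]
  exact div_le_div_of_nonneg_right
    (abs_sum_le_sqrt_sqNorm (M.occupancy_nonneg π) (M.sum_occupancy π) _) h.le

theorem sqNorm_le_of_concentrability_le (M : MDP S A) {ν μ : S × A → ℝ}
    {F : Finset (S × A → ℝ)} {π : Policy S A} {C : ℝ} (hC : 0 ≤ C) (hμ : ∀ x, 0 ≤ μ x)
    (h : M.concentrability ν μ F π ≤ ENNReal.ofReal C) {f : S × A → ℝ} (hf : f ∈ F) :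
    sqNorm ν (f - M.bellman π f) ≤ C * sqNorm μ (f - M.bellman π f) := by
  have h1 := (le_iSup₂ (f := fun f (_ : f ∈ F) => ENNReal.ofReal (sqNorm ν (f - M.bellman π f)) /
    ENNReal.ofReal (sqNorm μ (f - M.bellman π f))) f hf).trans h
  -- Finiteness of C handles a zero denominator: there x / 0 = ∞ is excluded unless x = 0.
  have h2 := (ENNReal.div_le_iff_le_mul (Or.inr ENNReal.ofReal_ne_top)
    (Or.inl ENNReal.ofReal_ne_top)).1 h1
  rw [← ENNReal.ofReal_mul hC] at h2
  exact (ENNReal.ofReal_le_ofReal_iff (mul_nonneg hC (sqNorm_nonneg hμ _))).1 h2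

/-- Finiteness of F makes the infimum attained; finiteness of N makes the real supremum a genuine
upper bound rather than the default value 0. -/
theorem exists_sqNorm_le_of_realizabilityError_le (M : MDP S A) {F : Finset (S × A → ℝ)}
    (hF : F.Nonempty) {N : Set (S × A → ℝ)} (hN : N.Finite) {π : Policy S A} {ε : ℝ}
    (h : M.realizabilityError F N π ≤ ε) :
    ∃ f ∈ F, ∀ ν ∈ N, sqNorm ν (f - M.bellman π f) ≤ ε := by
  have : Nonempty F := hF.to_subtype
  have : Finite N := hN
  obtain ⟨f, hf⟩ := exists_eq_ciInf_of_finite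
    (f := fun f : F => ⨆ ν : N, sqNorm ν.1 (f.1 - M.bellman π f.1))
  refine ⟨f, f.2, fun ν hν => ?_⟩
  exact (le_ciSup (f := fun ν : N => sqNorm ν.1 (f.1 - M.bellman π f.1))
    (Set.finite_range _).bddAbove ⟨ν, hν⟩).trans (hf.le.trans h)

theorem exists_sqNorm_le_of_completenessError_le (M : MDP S A) {F : Finset (S × A → ℝ)}
    {μ : S × A → ℝ} {π : Policy S A} {ε : ℝ} (h : M.completenessError F μ π ≤ ε)
    {f : S × A → ℝ} (hf : f ∈ F) : ∃ f' ∈ F, sqNorm μ (f' - M.bellman π f) ≤ ε := by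
  have : Nonempty F := ⟨⟨f, hf⟩⟩
  obtain ⟨f', hf'⟩ := exists_eq_ciInf_of_finite
    (f := fun f' : F => sqNorm μ (f'.1 - M.bellman π f))
  exact ⟨f', f'.2, hf'.le.trans ((le_ciSup
    (f := fun f : F => ⨅ f' : F, sqNorm μ (f'.1 - M.bellman π f.1))
    (Set.finite_range _).bddAbove ⟨f, hf⟩).trans h)⟩

/-- Suboptimality of the pessimistic policy on a dataset whose version spaces contain good
approximations of all values and only small Bellman errors for the comparator. -/
theorem J_sub_J_le_of_isPessimisticPolicy (M : MDP S A) {F : Finset (S × A → ℝ)}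
    {Pol : Finset (Policy S A)} {ε : ℝ} {n : ℕ} {πhat : (Fin n → Transition S A) → Policy S A}
    (hπhat : M.IsPessimisticPolicy F Pol ε πhat) {πstar : Policy S A} (hmem : πstar ∈ Pol)
    {D : Fin n → Transition S A} {a b : ℝ}
    (ha : ∀ π ∈ Pol, ∃ f ∈ M.versionSpace F D ε π,
      sqNorm (M.occupancy π) (f - M.bellman π f) ≤ a)
    (hb : ∀ f ∈ M.versionSpace F D ε πstar,
      sqNorm (M.occupancy πstar) (f - M.bellman πstar f) ≤ b) :
    M.J πstar - M.J (πhat D) ≤ (√a + √b) / (1 - M.γ) := by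
  have hγ : 0 < 1 - M.γ := by linarith [M.γ_lt_one]
  have hfin : ∀ π, Finite (M.versionSpace F D ε π) := fun π =>
    (F.finite_toSet.subset fun f hf => hf.1).to_subtype
  obtain ⟨h1, h2⟩ := hπhat D
  have h3 := h2 (fun π hπ => (ha π hπ).imp fun f hf => hf.1) πstar hmem
  -- For the learned policy one good member suffices, as the minimum lies below its value; for the
  -- comparator the minimizer is arbitrary, so `hb` must cover every member.
  obtain ⟨f, hf, hfa⟩ := ha _ h1
  have : Nonempty (M.versionSpace F D ε πstar) :=
    Set.Nonempty.to_subtype ((ha _ hmem).imp fun f hf => hf.1)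
  obtain ⟨g, hg⟩ := exists_eq_ciInf_of_finite
    (f := fun f : M.versionSpace F D ε πstar => policyValue f.1 M.s₀ πstar)
  have h4 : M.pessimisticValue F D ε (πhat D) ≤ policyValue f M.s₀ (πhat D) :=
    ciInf_le (f := fun f : M.versionSpace F D ε (πhat D) => policyValue f.1 M.s₀ (πhat D))
      (Set.finite_range _).bddBelow ⟨f, hf⟩
  rw [pessimisticValue, ← hg] at h3
  have h5 := (abs_le.1 (M.abs_policyValue_sub_J_le (πhat D) f)).2
  have h6 := (abs_le.1 (M.abs_policyValue_sub_J_le πstar g.1)).1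
  have h7 := div_le_div_of_nonneg_right (Real.sqrt_le_sqrt hfa) hγ.le
  have h8 := div_le_div_of_nonneg_right (Real.sqrt_le_sqrt (hb g.1 g.2)) hγ.le
  rw [add_div]
  linarith

end MDP

/-! ### Tail bounds for the two kinds of bad event. -/

namespace MDP

variable {S A : Type*} [Fintype S] [Fintype A]

/-- The excess empirical loss of a nearly Bellman-consistent function is small with high
probability. -/
theorem measureReal_lt_empLoss_sub_le [MeasurableSpace S] [DiscreteMeasurableSpace S]
    [MeasurableSpace A] [DiscreteMeasurableSpace A] (M : MDP S A) (hV : 0 < M.Vmax)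
    (μ : PMF (S × A)) {f f' : S × A → ℝ}
    (hf : ∀ x, f x ∈ Set.Icc 0 M.Vmax) (hf' : ∀ x, f' x ∈ Set.Icc 0 M.Vmax)
    (π : Policy S A) {n : ℕ} (hn : 0 < n) {ε L : ℝ} (hL : 0 ≤ L)
    (hε : sqNorm (massFun μ) (f - M.bellman π f) ≤ ε) :
    (M.datasetLaw μ n).real
      {D | 139 * M.Vmax ^ 2 * L / n + 39 * ε < M.empLoss D f f π - M.empLoss D f' f π}
        ≤ Real.exp (-(2 * L)) := by
  have hn' : (0 : ℝ) < n := by exact_mod_cast hn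
  have hε0 : 0 ≤ ε := (sqNorm_nonneg (massFun_nonneg μ) _).trans hε
  -- At l = 1/(8 Vmax²) the second-order term is l(G + H), which cancels the −lH of the mean.
  -- Nothing is then needed about f'.
  refine (measureReal_mono fun D hD => ?_).trans ((M.measureReal_le_empLoss_sub_le μ hf hf' hf π
    (l := 1 / (8 * M.Vmax ^ 2)) (by positivity) (by field_simp; norm_num) hn
    (139 * M.Vmax ^ 2 * L / n + 39 * ε)).trans (Real.exp_le_exp.2 ?_))
  · simp only [Set.mem_ofPred_eq] at hD ⊢
    exact hD.le
  set G := sqNorm (massFun μ) (f - M.bellman π f)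
  set H := sqNorm (massFun μ) (f' - M.bellman π f)
  set V := M.Vmax
  have e : n * (-(1 / (8 * V ^ 2) * (139 * V ^ 2 * L / n + 39 * ε)) + (1 / (8 * V ^ 2) * (G - H)
      + 8 * (1 / (8 * V ^ 2)) ^ 2 * V ^ 2 * (G + H)))
      = -(139 / 8 * L) + n / (8 * V ^ 2) * (2 * G - 39 * ε) := by
    field_simp
    ring
  rw [e]
  have : n / (8 * V ^ 2) * (2 * G - 39 * ε) ≤ 0 :=
    mul_nonpos_of_nonneg_of_nonpos (by positivity) (by linarith)
  linarith

/-- A function with a large Bellman error has a large excess empirical loss with high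
probability. -/
theorem measureReal_empLoss_sub_le_le [MeasurableSpace S] [DiscreteMeasurableSpace S]
    [MeasurableSpace A] [DiscreteMeasurableSpace A] (M : MDP S A) (hV : 0 < M.Vmax)
    (μ : PMF (S × A)) {f f' : S × A → ℝ}
    (hf : ∀ x, f x ∈ Set.Icc 0 M.Vmax) (hf' : ∀ x, f' x ∈ Set.Icc 0 M.Vmax)
    (π : Policy S A) {n : ℕ} (hn : 0 < n) {ε L η : ℝ}
    (hε : sqNorm (massFun μ) (f' - M.bellman π f) ≤ ε)
    (hlarge : 3 * ε + 2 * η + 64 * M.Vmax ^ 2 * L / n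
      < sqNorm (massFun μ) (f - M.bellman π f)) :
    (M.datasetLaw μ n).real {D | M.empLoss D f f π - M.empLoss D f' f π ≤ η}
        ≤ Real.exp (-(2 * L)) := by
  have hn' : (0 : ℝ) < n := by exact_mod_cast hn
  -- The roles of f and f' are exchanged. Halving l leaves (l/2)(3H − G), so a large G still
  -- dominates; 64 Vmax² L / n is the excess that produces −2L.
  refine (measureReal_mono fun D hD => ?_).trans ((M.measureReal_le_empLoss_sub_le μ hf' hf hf π
    (l := 1 / (16 * M.Vmax ^ 2)) (by positivity) (by field_simp; norm_num) hn
    (-η)).trans (Real.exp_le_exp.2 ?_))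
  · simp only [Set.mem_ofPred_eq] at hD ⊢
    linarith
  set G := sqNorm (massFun μ) (f - M.bellman π f)
  set H := sqNorm (massFun μ) (f' - M.bellman π f)
  set V := M.Vmax
  have e : n * (-(1 / (16 * V ^ 2) * (-η)) + (1 / (16 * V ^ 2) * (H - G)
      + 8 * (1 / (16 * V ^ 2)) ^ 2 * V ^ 2 * (H + G)))
      = n / (32 * V ^ 2) * (3 * H + 2 * η + 64 * V ^ 2 * L / n - G) - 2 * L := by
    field_simp
    ring
  rw [e]
  have : n / (32 * V ^ 2) * (3 * H + 2 * η + 64 * V ^ 2 * L / n - G) ≤ 0 :=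
    mul_nonpos_of_nonneg_of_nonpos (by positivity) (by linarith)
  linarith

theorem J_eq_zero_of_Vmax_eq_zero (M : MDP S A) (h : M.Vmax = 0) (π : Policy S A) :
    M.J π = 0 := by
  have hR : ∀ x, M.R x = 0 := fun x =>
    le_antisymm ((M.R_le x).trans (by rw [M.Rmax_eq, h, mul_zero])) (M.R_nonneg x)
  simp [J, hR]

end MDP

/-- A set that contains the complement of a rare event is likely; no measurability is needed. -/
theorem ofReal_one_sub_le_of_subset {Ω : Type*} [MeasurableSpace Ω] {P : Measure Ω}
    [IsProbabilityMeasure P] {δ : ℝ} {good bad : Set Ω}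
    (hsub : badᶜ ⊆ good) (hbad : P.real bad ≤ δ) : ENNReal.ofReal (1 - δ) ≤ P good := by
  have h : (1 : ℝ) ≤ P.real good + P.real bad := by
    rw [← probReal_univ (μ := P)]
    refine (measureReal_mono ?_).trans (measureReal_union_le good bad)
    intro D _
    by_cases hD : D ∈ bad
    · exact Or.inr hD
    · exact Or.inl (hsub hD)
  rw [← ofReal_measureReal]
  exact ENNReal.ofReal_le_ofReal (by linarith)

/-- Under the second root, V² l has coefficient 2·139 + 64 = 342 ≤ 19² and εF has coefficient 78 ≤
9². -/
theorem sqrt_add_sqrt_le_rate {εF εFF C V l : ℝ} (hF : 0 ≤ εF) (hFF : 0 ≤ εFF) (hC : 1 ≤ C)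
    (hV : 0 ≤ V) (hl : 0 ≤ l) :
    √εF + √(C * (3 * εFF + 2 * (139 * V ^ 2 * l + 39 * εF) + 64 * V ^ 2 * l))
      ≤ 20 * (V * √C * √l + √(C * (εFF + εF))) := by
  have hC0 : 0 ≤ C := by linarith
  have h1 : √εF ≤ √(C * (εFF + εF)) := Real.sqrt_le_sqrt (by nlinarith)
  have h2 : √(C * (3 * εFF + 2 * (139 * V ^ 2 * l + 39 * εF) + 64 * V ^ 2 * l))
      ≤ 19 * (V * √C * √l) + 9 * √(C * (εFF + εF)) := by
    apply Real.sqrt_le_left (by positivity) |>.2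
    have e1 : (V * √C * √l) ^ 2 = V ^ 2 * C * l := by
      rw [mul_pow, mul_pow, Real.sq_sqrt hC0, Real.sq_sqrt hl]
    have e2 : √(C * (εFF + εF)) ^ 2 = C * (εFF + εF) := Real.sq_sqrt (by positivity)
    have h3 : 0 ≤ (V * √C * √l) * √(C * (εFF + εF)) := by positivity
    have h4 : 0 ≤ V ^ 2 * C * l := by positivity
    have h5 : 0 ≤ C * εFF := by positivity
    have h6 : 0 ≤ C * εF := by positivity
    nlinarith
  have h7 : 0 ≤ V * √C * √l := by positivity
  have h8 := Real.sqrt_nonneg (C * (εFF + εF))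
  linarith

/-! ### Assembly: bad events and union bound. -/

theorem mainTheorem3 :
    ∃ c : ℝ, 0 < c ∧
      ∀ {S A : Type*} [Fintype S] [Fintype A]
        [MeasurableSpace S] [DiscreteMeasurableSpace S]
        [MeasurableSpace A] [DiscreteMeasurableSpace A]
        (M : MDP S A) (μ : PMF (S × A))
        (F : Finset (S × A → ℝ)) (Pol : Finset (Policy S A))
        (_hF : F.Nonempty) (_hFV : ∀ f ∈ F, ∀ x, f x ∈ Set.Icc 0 M.Vmax)
        (εF εFF : ℝ)
        -- realizability, under the occupancies of the policy class and under the data distribution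
        (_hreal : ∀ π ∈ Pol, M.realizabilityError F
          (insert (massFun μ) {ν | ∃ π' ∈ Pol, ν = M.occupancy π'}) π ≤ εF)
        -- completeness
        (_hcomp : ∀ π ∈ Pol, M.completenessError F (massFun μ) π ≤ εFF)
        (n : ℕ) (_hn : 0 < n) (δ : ℝ) (_hδ : 0 < δ) (_hδ1 : δ < 1)
        (πhat : (Fin n → Transition S A) → Policy S A)
        (_hπhat : M.IsPessimisticPolicy F Pol (M.threshold F Pol δ n εF) πhat)
        -- an optimal policy, covered by the data
        (πstar : Policy S A) (_hmem : πstar ∈ Pol) (_hopt : ∀ π, M.J π ≤ M.J πstar)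
        (C₂ : ℝ) (_hC₂ : 1 ≤ C₂)
        (_hcov : M.concentrability (M.occupancy πstar) (massFun μ) F πstar ≤ ENNReal.ofReal C₂),
        ENNReal.ofReal (1 - δ) ≤ M.datasetLaw μ n {D |
          M.J πstar - M.J (πhat D) ≤
            c * (M.Vmax * √C₂ / (1 - M.γ) *
                  √(Real.log ((F.card : ℝ) * (Pol.card : ℝ) / δ) / n)
                + √(C₂ * (εFF + εF)) / (1 - M.γ))} := by
  refine ⟨20, by norm_num, ?_⟩
  intro S A _ _ _ _ _ _ M μ F Pol hF hFV εF εFF hreal hcomp n hn δ hδ hδ1 πhat hπhat πstar hmem _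
    C₂ hC₂ hcov
  classical
  have hγ : 0 < 1 - M.γ := by linarith [M.γ_lt_one]
  have hV0 := M.Vmax_nonneg πstar
  -- The choices of l divide by Vmax², so Vmax = 0 is separated; all returns then vanish.
  rcases hV0.eq_or_lt with hV | hV
  · refine ofReal_one_sub_le_of_subset (bad := ∅) (fun D _ => ?_) (by simpa using hδ.le)
    rw [Set.mem_ofPred_eq, M.J_eq_zero_of_Vmax_eq_zero hV.symm,
      M.J_eq_zero_of_Vmax_eq_zero hV.symm, sub_zero]
    positivity
  have hN : (insert (massFun μ) {ν | ∃ π' ∈ Pol, ν = M.occupancy π'}).Finite := by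
    refine Set.Finite.insert _ ((Pol.finite_toSet.image M.occupancy).subset ?_)
    rintro _ ⟨π', hπ', rfl⟩
    exact ⟨π', hπ', rfl⟩
  -- A single q π is good under μ and under all occupancies: the former puts it in the version
  -- space, the latter controls its value.
  choose! q hqF hq using fun π hπ =>
    M.exists_sqNorm_le_of_realizabilityError_le hF hN (hreal π hπ)
  choose! p hpF hp using fun f (hf : f ∈ F) =>
    M.exists_sqNorm_le_of_completenessError_le (hcomp πstar hmem) hf
  have hqμ : ∀ π ∈ Pol, sqNorm (massFun μ) (q π - M.bellman π (q π)) ≤ εF :=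
    fun π hπ => hq π hπ _ (Set.mem_insert _ _)
  have hεF : 0 ≤ εF := (sqNorm_nonneg (massFun_nonneg μ) _).trans (hqμ _ hmem)
  have hεFF : 0 ≤ εFF :=
    (sqNorm_nonneg (massFun_nonneg μ) _).trans (hp _ (hqF _ hmem))
  set N : ℝ := (F.card : ℝ) * (Pol.card : ℝ) with hNdef
  have hF1 : (1 : ℝ) ≤ F.card := by exact_mod_cast hF.card_pos
  have hP1 : (1 : ℝ) ≤ Pol.card := by exact_mod_cast Finset.card_pos.2 ⟨_, hmem⟩
  have hN1 : 1 ≤ N := one_le_mul_of_one_le_of_one_le hF1 hP1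
  set L := Real.log (N / δ) with hLdef
  have hL : 0 ≤ L := Real.log_nonneg ((one_le_div hδ).2 (hδ1.le.trans hN1))
  have hn' : (0 : ℝ) < n := by exact_mod_cast hn
  have hthr : M.threshold F Pol δ n εF = 139 * M.Vmax ^ 2 * L / n + 39 * εF := rfl
  set η := M.threshold F Pol δ n εF with hη
  set B := 3 * εFF + 2 * η + 64 * M.Vmax ^ 2 * L / n with hB
  have hη0 : 0 ≤ η := by rw [hthr]; positivity
  let bad₁ : Policy S A → (S × A → ℝ) → Set (Fin n → Transition S A) := fun π f' =>
    {D | η < M.empLoss D (q π) (q π) π - M.empLoss D f' (q π) π}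
  -- The second condition does not involve D, so the event is empty unless f has a large residual.
  let bad₂ : (S × A → ℝ) → Set (Fin n → Transition S A) := fun f =>
    {D | M.empLoss D f f πstar - M.empLoss D (p f) f πstar ≤ η ∧
      B < sqNorm (massFun μ) (f - M.bellman πstar f)}
  have h₁ : ∀ π ∈ Pol, ∀ f' ∈ F, (M.datasetLaw μ n).real (bad₁ π f') ≤ Real.exp (-(2 * L)) :=
    fun π hπ f' hf' => M.measureReal_lt_empLoss_sub_le hV μ (hFV _ (hqF π hπ)) (hFV _ hf') π hn hL
      (hqμ π hπ)
  have h₂ : ∀ f ∈ F, (M.datasetLaw μ n).real (bad₂ f) ≤ Real.exp (-(2 * L)) := by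
    intro f hf
    by_cases hlarge : B < sqNorm (massFun μ) (f - M.bellman πstar f)
    · exact (measureReal_mono fun D hD => hD.1).trans (M.measureReal_empLoss_sub_le_le hV μ
        (hFV _ hf) (hFV _ (hpF f hf)) πstar hn (hp f hf) hlarge)
    · simp [bad₂, hlarge, Real.exp_nonneg]
  refine ofReal_one_sub_le_of_subset
    (bad := (⋃ π ∈ Pol, ⋃ f' ∈ F, bad₁ π f') ∪ ⋃ f ∈ F, bad₂ f) (fun D hD => ?_) ?_
  · simp only [Set.mem_compl_iff, Set.mem_union, Set.mem_iUnion, not_or, not_exists] at hD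
    have ha : ∀ π ∈ Pol, ∃ f ∈ M.versionSpace F D η π,
        sqNorm (M.occupancy π) (f - M.bellman π f) ≤ εF := fun π hπ =>
      ⟨q π, M.mem_versionSpace_of_forall (hqF π hπ) fun f' hf' => not_lt.1 (hD.1 π hπ f' hf'),
        hq π hπ _ (Set.mem_insert_of_mem _ ⟨π, hπ, rfl⟩)⟩
    have hb : ∀ f ∈ M.versionSpace F D η πstar,
        sqNorm (M.occupancy πstar) (f - M.bellman πstar f) ≤ C₂ * B := by
      intro f hf
      refine (M.sqNorm_le_of_concentrability_le (by linarith) (massFun_nonneg μ) hcov hf.1).trans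
        (mul_le_mul_of_nonneg_left ?_ (by linarith))
      by_contra! hlt
      exact hD.2 f hf.1 ⟨M.empLoss_sub_le_of_mem_versionSpace hf (hpF f hf.1), hlt⟩
    refine (M.J_sub_J_le_of_isPessimisticPolicy hπhat hmem ha hb).trans ?_
    have hrate := sqrt_add_sqrt_le_rate hεF hεFF hC₂ hV.le (div_nonneg hL hn'.le)
    rw [hB, hthr, mul_div_assoc, mul_div_assoc]
    refine (div_le_div_of_nonneg_right hrate hγ.le).trans (le_of_eq ?_)
    ring
  -- The union bound gives 2δ²/N, which is at most δ once N ≥ 2. If F is a singleton, all losses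
  -- coincide and completeness bounds the residual of its only member, so no bad event can occur.
  · rcases (Nat.one_le_iff_ne_zero.2 hF.card_ne_zero).eq_or_lt with h1 | h1
    · obtain ⟨f₀, hf₀⟩ := Finset.card_eq_one.1 h1.symm
      have hF₀ : ∀ f ∈ F, f = f₀ := fun f hf => by simpa [hf₀] using hf
      have e₁ : ∀ π ∈ Pol, ∀ f' ∈ F, bad₁ π f' = ∅ := by
        intro π hπ f' hf'
        simp only [bad₁]
        rw [hF₀ f' hf', hF₀ _ (hqF π hπ)]
        simp [hη0.not_gt]
      have e₂ : ∀ f ∈ F, bad₂ f = ∅ := by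
        intro f hf
        have h := hp f hf
        rw [(hF₀ _ (hpF f hf)).trans (hF₀ f hf).symm] at h
        have : 0 ≤ 64 * M.Vmax ^ 2 * L / n := by positivity
        have : ¬ B < sqNorm (massFun μ) (f - M.bellman πstar f) := by linarith
        simp [bad₂, this]
      have e : (⋃ π ∈ Pol, ⋃ f' ∈ F, bad₁ π f') ∪ ⋃ f ∈ F, bad₂ f = ∅ := by
        simp only [Set.union_empty_iff, Set.iUnion_eq_empty]
        exact ⟨e₁, e₂⟩
      rw [e, measureReal_empty]
      exact hδ.le
    · have hF2 : (2 : ℝ) ≤ F.card := by exact_mod_cast h1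
      have hN2 : 2 ≤ N := by nlinarith
      have hx : Real.exp (-(2 * L)) = (δ / N) ^ 2 := by
        rw [← inv_div N δ, ← Real.exp_log (by positivity : 0 < (N / δ)⁻¹), Real.log_inv,
          ← Real.exp_nat_mul]
        congr 1
        push_cast
        ring
      have b₁ : (M.datasetLaw μ n).real (⋃ π ∈ Pol, ⋃ f' ∈ F, bad₁ π f')
          ≤ N * Real.exp (-(2 * L)) := by
        refine (measureReal_biUnion_finset_le _ _).trans ((Finset.sum_le_sum fun π hπ =>
          (measureReal_biUnion_finset_le _ _).trans (Finset.sum_le_sum (h₁ π hπ))).trans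
            (le_of_eq ?_))
        simp only [Finset.sum_const, nsmul_eq_mul, hNdef]
        ring
      have b₂ : (M.datasetLaw μ n).real (⋃ f ∈ F, bad₂ f) ≤ N * Real.exp (-(2 * L)) := by
        refine (measureReal_biUnion_finset_le _ _).trans ((Finset.sum_le_sum h₂).trans ?_)
        rw [Finset.sum_const, nsmul_eq_mul]
        exact mul_le_mul_of_nonneg_right (le_mul_of_one_le_right (by linarith) hP1)
          (Real.exp_pos _).le
      refine (measureReal_union_le _ _).trans ((add_le_add b₁ b₂).trans ?_)
      rw [hx, div_pow, ← two_mul]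
      calc 2 * (N * (δ ^ 2 / N ^ 2)) = (2 / N) * (δ * δ) := by field_simp
        _ ≤ 1 * (δ * 1) := mul_le_mul ((div_le_one (by linarith)).2 hN2)
          (mul_le_mul_of_nonneg_left hδ1.le hδ.le) (by positivity) zero_le_one
        _ = δ := by ring
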